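/- Conventions. A *-algebra is a unital associative complex algebra $A$ (the case $A=\{0\}$ is allowed) with an antilinear involution $a\mapsto a^*$ satisfying $(ab)^*=b^*a^*$; $A_H=\{a\in A: a=a^*\}$ is the real subspace of Hermitian elements and $1$ is the unit. An ordered *-algebra is a *-algebra with a partial order $\le$ on $A_H$ such that $0\le 1$, and such that $a+c\le b+c$ and $d^*ad\le d^*bd$ whenever $a,b,c\in A_H$, $a\le b$ and $d\in A$. It is Archimedean if, for $v,w\in A_H$, $v\le\epsilon w$ for all real $\epsilon>0$ implies $v\le 0$. Put $\|a\|_\infty=\inf\{\lambda\in(0,\infty): a^*a\le\lambda^2 1\}\in[0,\infty]$ for $a\in A$ (with $\inf\emptyset=\infty$); an Archimedean ordered *-algebra $A$ is uniformly complete if it is complete for the metric $d_\infty(a,b)=\min\{\|a-b\|_\infty,1\}$. An element $a\in A_H$ is coercive if $a\ge\epsilon 1$ for some real $\epsilon>0$. $A$ is symmetric if every coercive element is invertible, and radical if, for all commuting $a,b\in A_H$ with $a$ coercive and $ab\ge0$, one has $b\ge 0$. For $S\subseteq A$, $S''$ denotes the bicommutant of $S$ in $A$. Let $A$ be a radical Archimedean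 ordered *-algebra. For commuting $a,b\in A_H$, $a\vee b$ (resp. $a\wedge b$) denotes, if it exists, the element $x\in\{a,b\}''\cap A_H$ with $x^2+ab=x(a+b)$ and $2x\ge a+b$ (resp. $2x\le a+b$). For $a\in A_H$, the absolute value is $|a|=a\vee(-a)$, if it exists. For $a\in A_H$ with $a\ge0$, the square root $\sqrt a$ is, if it exists, the element $x\in\{a\}''\cap A_H$ with $x\ge0$ and $x^2=a$. (These elements are unique when they exist.) $A$ is a $\Phi^*$-algebra if $a\vee b$ and $a\wedge b$ exist for all commuting $a,b\in A_H$. Theorem. Let $A$ be a uniformly complete Archimedean ordered *-algebra. Then the following are equivalent: (i) $a+\mathrm{i}1$ and $a-\mathrm{i}1$ are invertible for every $a\in A_H$; (ii) every coercive element of $A_H$ is invertible, i.e. $A$ is symmetric; (iii) $A$ is radical and $\sqrt a$ exists for every $a\in A_H$ with $a\ge 0$; (iv) $A$ is radical and $|a|$ exists for every $a\in A_H$; (v) $A$ is radical and both $a\vee b$ and $a\wedge b$ exist for all commuting $a,b\in A_H$, i.e. $A$ is a $\Phi^*$-algebra; (vi) $A$ is radical and $a\wedge 1$ exists for every coercive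 $a\in A_H$. -/

import Mathlib

open scoped ENNReal

/-!
Conventions: a (unital) `*`-algebra is a complex unital associative algebra with an antilinear,
antimultiplicative involution, that is
`[Ring A] [StarRing A] [Algebra ℂ A] [StarModule ℂ A]`.
Its real linear subspace of Hermitian elements is Mathlib's `selfAdjoint A`, and the order lives on
`selfAdjoint A` only.
-/

namespace OrdStar

section Defs

variable {A : Type*} [Ring A] [StarRing A] [Algebra ℂ A] [StarModule ℂ A]

/-- The Hermitian element `d* a d`, for `a` Hermitian and `d` arbitrary. -/
def conj (d : A) (a : selfAdjoint A) : selfAdjoint A :=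
  ⟨star d * (a : A) * d, IsSelfAdjoint.conjugate' a.2 d⟩

/-- The Hermitian element `a* a`. -/
def starMulSelf (a : A) : selfAdjoint A :=
  ⟨star a * a, IsSelfAdjoint.star_mul_self a⟩

/-- The product `a b` of two commuting Hermitian elements, as a Hermitian element. -/
def mulOfCommute (a b : selfAdjoint A) (h : Commute (a : A) (b : A)) : selfAdjoint A :=
  ⟨(a : A) * (b : A), (IsSelfAdjoint.commute_iff a.2 b.2).mp h⟩

/-- The bicommutant `S''` of a subset `S`. -/
def bicommutant (S : Set A) : Set A := Set.centralizer (Set.centralizer S)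

end Defs

/-- `A` is an ordered `*`-algebra: the partial order on the Hermitian elements is
translation invariant, invariant under `a ↦ d* a d`, and `0 ≤ 1`. -/
class IsOrderedStarAlgebra (A : Type*) [Ring A] [StarRing A] [Algebra ℂ A] [StarModule ℂ A]
    [PartialOrder (selfAdjoint A)] : Prop where
  add_le_add_right : ∀ a b c : selfAdjoint A, a ≤ b → a + c ≤ b + c
  conj_le_conj : ∀ (a b : selfAdjoint A) (d : A), a ≤ b → conj d a ≤ conj d b
  zero_le_one : (0 : selfAdjoint A) ≤ 1

section Order

variable (A : Type*) [Ring A] [StarRing A] [Algebra ℂ A] [StarModule ℂ A]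
  [PartialOrder (selfAdjoint A)]

/-- The ordered real vector space of Hermitian elements is Archimedean
(in the sense of ordered vector spaces). -/
def IsArchimedean : Prop :=
  ∀ v w : selfAdjoint A, (∀ ε : ℝ, 0 < ε → v ≤ ε • w) → v ≤ 0

variable {A}

/-- `‖a‖_∞ = inf {r ∈ ]0,∞[ | a* a ≤ r² 1}`, with values in `[0,∞]`; the infimum of the empty set
is `∞`. -/
noncomputable def uniformNorm (a : A) : ℝ≥0∞ :=
  sInf {t : ℝ≥0∞ | ∃ r : ℝ, 0 < r ∧ starMulSelf a ≤ (r ^ 2) • (1 : selfAdjoint A) ∧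
    t = ENNReal.ofReal r}

/-- The uniform metric `d_∞(a, b) = min {‖a - b‖_∞, 1}`. -/
noncomputable def uniformDist (a b : A) : ℝ :=
  (min (uniformNorm (a - b)) 1).toReal

variable (A) in
/-- `A` is complete with respect to the uniform metric. -/
def IsUniformlyComplete : Prop :=
  ∀ u : ℕ → A,
    (∀ ε : ℝ, 0 < ε → ∃ N : ℕ, ∀ m n : ℕ, N ≤ m → N ≤ n → uniformDist (u m) (u n) < ε) →
    ∃ l : A, ∀ ε : ℝ, 0 < ε → ∃ N : ℕ, ∀ n : ℕ, N ≤ n → uniformDist (u n) l < ε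

/-- A Hermitian element `a` is coercive if `a ≥ ε 1` for some real `ε > 0`. -/
def IsCoerciveElem (a : selfAdjoint A) : Prop :=
  ∃ ε : ℝ, 0 < ε ∧ ε • (1 : selfAdjoint A) ≤ a

variable (A) in
/-- Every coercive element has a multiplicative inverse. -/
def IsSymmetricAlgebra : Prop :=
  ∀ a : selfAdjoint A, IsCoerciveElem a → IsUnit (a : A)

variable (A) in
/-- `A` is radical: if `a`, `b` are commuting Hermitian elements, `a` is coercive and `a b ≥ 0`,
then `b ≥ 0`. -/
def IsRadicalAlgebra : Prop :=
  ∀ (a b : selfAdjoint A) (h : Commute (a : A) (b : A)),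
    IsCoerciveElem a → 0 ≤ mulOfCommute a b h → 0 ≤ b

/-- `x = a ∨ b`: the Hermitian element of `{a, b}''` with `2 x ≥ a + b` and
`x² + a b = x (a + b)`. -/
def IsVee (a b x : selfAdjoint A) : Prop :=
  (x : A) ∈ bicommutant {(a : A), (b : A)} ∧
    a + b ≤ (2 : ℝ) • x ∧
    (x : A) ^ 2 + (a : A) * (b : A) = (x : A) * ((a : A) + (b : A))

/-- `x = a ∧ b`: the Hermitian element of `{a, b}''` with `2 x ≤ a + b` and
`x² + a b = x (a + b)`. -/
def IsWedge (a b x : selfAdjoint A) : Prop :=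
  (x : A) ∈ bicommutant {(a : A), (b : A)} ∧
    (2 : ℝ) • x ≤ a + b ∧
    (x : A) ^ 2 + (a : A) * (b : A) = (x : A) * ((a : A) + (b : A))

/-- `x = |a|`, that is `x = a ∨ (-a)`. -/
def IsAbsoluteValue (a x : selfAdjoint A) : Prop := IsVee a (-a) x

/-- `x = √a`: the positive Hermitian element of `{a}''` with `x² = a`. -/
def IsSquareRoot (a x : selfAdjoint A) : Prop :=
  (x : A) ∈ bicommutant {(a : A)} ∧ 0 ≤ x ∧ (x : A) ^ 2 = (a : A)

variable (A) in
/-- A `Φ*`-algebra is a radical Archimedean ordered `*`-algebra in which `a ∨ b` and `a ∧ b` exist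
for all commuting Hermitian elements `a` and `b`. -/
def IsPhiStarAlgebra : Prop :=
  IsOrderedStarAlgebra A ∧ IsArchimedean A ∧ IsRadicalAlgebra A ∧
    ∀ a b : selfAdjoint A, Commute (a : A) (b : A) →
      (∃ x : selfAdjoint A, IsVee a b x) ∧ (∃ x : selfAdjoint A, IsWedge a b x)

end Order

end OrdStar

/-!
Every condition concerns one Hermitian element, or two commuting ones, and can be tested inside the
Hermitian part `R` of the bicommutant of these elements (`hermitianBicommutant`). This is a
commutative real algebra, closed under the inverses that exist in `A`, with an Archimedean order for
which multiplication by squares preserves positivity (`IsArchimedeanSquareOrdered`). It is complete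
for the order unit `1`: commutation with an unbounded element survives uniform limits because the
commutator of `c` with an element of size `ε` is at most `ε (c ^ 2 + 1)` (`commutator_le`,
`mem_bicommutant_of_approx`).

In such an `R` the product of a positive element with a *bounded* positive element is positive
(`mul_nonneg_of_bounded`), and a monotone iteration with a scalar majorant (`exists_fixedPoint`)
provides square roots of elements between `0` and `1` and inverses of bounded coercive elements. For
unbounded elements:

* As `(a + i)(a - i) = a ^ 2 + 1`, condition (i) says that all `a ^ 2 + 1` are invertible, which
  follows from symmetry. Conversely, for `a ≥ ε` the bounded element `h = (a ^ 2 + 1)⁻¹` satisfies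
  `h ≤ 1 / (1 + ε ^ 2)`, so that `a ^ 2 h = 1 - h` is invertible (`isUnit_of_sq_add_one_inv`).
* Symmetry makes the inverse of a coercive element available, and this inverse is positive and
  bounded. Hence `A` is radical (`nonneg_of_mul_nonneg_of_inv`), and with `b = (1 + a)⁻¹` the square
  root of `a ≥ 0` is `√(1 - b) (√b)⁻¹` (`exists_sqrt_of_inv`).
* Square roots give absolute values by `|a| = √(a ^ 2)`, and these give `a ∨ b` and `a ∧ b` by
  `(a + b ± |a - b|) / 2`.
* If `A` is radical and `a ∧ 1` exists for coercive `a`, then the truncations `a ∧ n` exist by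
  scaling, they are bounded and coercive, and their inverses are uniformly Cauchy with the inverse
  of `a` as limit (`isUnit_of_forall_wedge`).
-/

namespace OrdStar

/-! ### Archimedean square-ordered commutative rings -/

/-- A commutative real algebra with a translation invariant Archimedean partial order for which
`1` is positive and the positive elements are stable under multiplication by squares. The product
of two arbitrary positive elements need not be positive. -/
class IsArchimedeanSquareOrdered (R : Type*) [CommRing R] [Algebra ℝ R] [PartialOrder R] : Prop
    extends IsOrderedAddMonoid R where
  mul_self_mul_nonneg : ∀ d c : R, 0 ≤ c → 0 ≤ d * d * c
  one_nonneg : (0 : R) ≤ 1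
  archimedean : ∀ v w : R, (∀ ε : ℝ, 0 < ε → v ≤ ε • w) → v ≤ 0

/-- `-r ≤ x ≤ r` for a real number `r`. -/
def AbsLE {R : Type*} [CommRing R] [Algebra ℝ R] [PartialOrder R] (x : R) (r : ℝ) : Prop :=
  -(r • (1 : R)) ≤ x ∧ x ≤ r • (1 : R)

/-- `0 ≤ x ≤ r` for a real number `r ≥ 0`. -/
def IsMajorized {R : Type*} [CommRing R] [Algebra ℝ R] [PartialOrder R] (x : R) (r : ℝ) : Prop :=
  0 ≤ r ∧ 0 ≤ x ∧ x ≤ r • (1 : R)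

/-- Sequential completeness with respect to the order unit `1`. -/
def IsOrderUnitComplete (R : Type*) [CommRing R] [Algebra ℝ R] [PartialOrder R] : Prop :=
  ∀ u : ℕ → R, (∀ ε : ℝ, 0 < ε → ∃ N : ℕ, ∀ m n : ℕ, N ≤ m → N ≤ n → u m - u n ≤ ε • (1 : R)) →
    ∃ l : R, ∀ ε : ℝ, 0 < ε → ∃ N : ℕ, ∀ n : ℕ, N ≤ n → AbsLE (u n - l) ε

section Commutative

variable {R : Type*} [CommRing R] [Algebra ℝ R] [PartialOrder R] [IsArchimedeanSquareOrdered R]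

open IsArchimedeanSquareOrdered

theorem sq_mul_nonneg (d : R) {c : R} (hc : 0 ≤ c) : 0 ≤ d ^ 2 * c := by
  simpa [sq] using mul_self_mul_nonneg d c hc

theorem sq_nonneg_of_squareOrdered (d : R) : 0 ≤ d ^ 2 := by
  simpa using sq_mul_nonneg d one_nonneg

instance : ZeroLEOneClass R := ⟨one_nonneg⟩

instance : IsOrderedModule ℝ R := by
  refine IsOrderedModule.of_smul_nonneg fun c hc x hx => ?_
  have h := sq_mul_nonneg (√c • (1 : R)) hx
  have e : (√c • (1 : R)) ^ 2 * x = c • x := by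
    nth_rw 2 [← Real.sq_sqrt hc]
    algebra
  rwa [e] at h

theorem le_of_sub_eq {x y z : R} (hz : 0 ≤ z) (h : y - x = z) : x ≤ y := by
  rwa [← sub_nonneg, h]

theorem smul_one_mono {r s : ℝ} (h : r ≤ s) : r • (1 : R) ≤ s • (1 : R) :=
  smul_le_smul_of_nonneg_right h one_nonneg

theorem nonneg_of_smul_nonneg {r : ℝ} (hr : 0 < r) {x : R} (h : 0 ≤ r • x) : 0 ≤ x := by
  have := smul_nonneg (inv_nonneg.2 hr.le) h
  rwa [inv_smul_smul₀ hr.ne'] at this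

theorem nonneg_of_forall_neg_smul_le {v w : R} (h : ∀ ε : ℝ, 0 < ε → -(ε • w) ≤ v) : 0 ≤ v := by
  have := archimedean (-v) w fun ε hε => neg_le.1 (h ε hε)
  simpa using this

theorem eq_zero_of_forall_abs_le_smul {v w : R}
    (h : ∀ ε : ℝ, 0 < ε → -(ε • w) ≤ v ∧ v ≤ ε • w) : v = 0 :=
  le_antisymm (archimedean v w fun ε hε => (h ε hε).2)
    (nonneg_of_forall_neg_smul_le fun ε hε => (h ε hε).1)

theorem le_one_of_sq_le {h : R} (hh : h ^ 2 ≤ h) : h ≤ 1 :=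
  le_of_sub_eq (add_nonneg (sq_nonneg_of_squareOrdered (1 - h)) (sub_nonneg.2 hh)) (by ring)

/-! ### Products of positive elements -/

/-- For `0 ≤ q ≤ 1`, iterating `x ↦ x - x ^ 2` from `q` writes `q` as a sum of squares plus a
remainder `r` with `0 ≤ r ≤ 1 / (n + 1)`. As multiplication by squares preserves positivity, this
gives `p * r ≤ p * q`. -/
theorem exists_sum_sq_remainder {p q : R} (hp : 0 ≤ p) (hq : 0 ≤ q) (hq1 : q ≤ 1) (n : ℕ) :
    ∃ r : R, 0 ≤ r ∧ r ≤ ((n + 1 : ℝ)⁻¹) • (1 : R) ∧ r ^ 2 ≤ r ∧ p * r ≤ p * q := by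
  have key : ∀ x : R, 0 ≤ x → x ≤ 1 → 0 ≤ x - x ^ 2 := fun x h0 h1 => by
    have := add_nonneg (sq_mul_nonneg x (sub_nonneg.2 h1)) (sq_mul_nonneg (1 - x) h0)
    convert this using 1
    ring
  induction n with
  | zero =>
    exact ⟨q, hq, by simpa using hq1, sub_nonneg.1 (key q hq hq1), le_rfl⟩
  | succ n ih =>
    obtain ⟨r, h0, h1, h2, h3⟩ := ih
    have hr1 : r ≤ 1 := le_one_of_sq_le h2
    have hb : r - r ^ 2 ≤ (((n + 1 : ℕ) + 1 : ℝ)⁻¹) • (1 : R) := by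
      -- the tangent of `r ↦ r - r ^ 2` at the point `t`
      have tangent : ∀ t : ℝ, t ≤ 1 / 2 → ∀ s : ℝ, r ≤ s • (1 : R) →
          r - r ^ 2 ≤ (t ^ 2 + (1 - 2 * t) * s) • (1 : R) := fun t ht s hs =>
        le_of_sub_eq (add_nonneg (sq_nonneg_of_squareOrdered (r - t • (1 : R)))
          (smul_nonneg (by linarith : 0 ≤ 1 - 2 * t) (sub_nonneg.2 hs))) (by algebra)
      rcases Nat.eq_zero_or_pos n with rfl | hn
      · refine (tangent (1 / 2) le_rfl _ h1).trans (smul_one_mono ?_)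
        norm_num
      · have hn' : (1 : ℝ) ≤ n := by exact_mod_cast hn
        refine (tangent (n + 1 : ℝ)⁻¹ ?_ _ h1).trans (smul_one_mono ?_)
        · rw [inv_le_comm₀ (by positivity) (by positivity)]
          linarith
        · push_cast
          rw [← sub_nonneg]
          have : ((n : ℝ) + 1 + 1)⁻¹ -
              ((n + 1 : ℝ)⁻¹ ^ 2 + (1 - 2 * (n + 1 : ℝ)⁻¹) * (n + 1 : ℝ)⁻¹) =
              1 / ((n + 1 + 1) * (n + 1) ^ 2) := by
            field_simp
            ring
          rw [this]
          positivity
    have h0' := key r h0 hr1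
    refine ⟨r - r ^ 2, h0', hb, sub_nonneg.1 (key _ h0' ?_), le_trans ?_ h3⟩
    · exact (sub_le_self _ (sq_nonneg_of_squareOrdered r)).trans hr1
    · exact le_of_sub_eq (sq_mul_nonneg r hp) (by ring)

/-- The error term `p * r` of `exists_sum_sq_remainder` need not be small, as `p` may be unbounded,
but it is small relative to `p ^ 2 + 1`, which is enough by the Archimedean property. -/
theorem mul_nonneg_of_le_one {p q : R} (hp : 0 ≤ p) (hq : 0 ≤ q) (hq1 : q ≤ 1) : 0 ≤ p * q := by
  refine nonneg_of_forall_neg_smul_le (w := p ^ 2 + 1) fun ε hε => ?_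
  obtain ⟨n, hn⟩ := exists_nat_one_div_lt (show (0 : ℝ) < ε ^ 2 by positivity)
  obtain ⟨r, -, h1, h2, h3⟩ := exists_sum_sq_remainder hp hq hq1 n
  refine le_trans ?_ h3
  have h4 : r ^ 2 ≤ (ε ^ 2) • (1 : R) :=
    h2.trans (h1.trans (smul_one_mono (by rw [← one_div]; exact hn.le)))
  -- `ε (p + r / (2 ε)) ^ 2 = ε p ^ 2 + p r + r ^ 2 / (4 ε)`
  have h5 := smul_nonneg hε.le (sq_nonneg_of_squareOrdered (p + (2 * ε)⁻¹ • r))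
  have h6 := smul_nonneg (by positivity : 0 ≤ (4 * ε)⁻¹) (sub_nonneg.2 h4)
  have h7 : (0 : R) ≤ (3 / 4 * ε) • (1 : R) := smul_nonneg (by positivity) one_nonneg
  refine le_of_sub_eq (add_nonneg (add_nonneg h5 h6) h7) ?_
  have e1 : ε * ((2 * ε)⁻¹ * 2) = 1 := by field_simp
  have e2 : ε * ((2 * ε)⁻¹) ^ 2 = (4 * ε)⁻¹ := by field_simp; ring
  have e3 : (4 * ε)⁻¹ * ε ^ 2 = ε / 4 := by field_simp
  calc p * r - -(ε • (p ^ 2 + 1))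
      = ε • p ^ 2 + (1 : ℝ) • (p * r) + ε • (1 : R) := by algebra
    _ = ε • p ^ 2 + (ε * ((2 * ε)⁻¹ * 2)) • (p * r) + (ε * ((2 * ε)⁻¹) ^ 2) • r ^ 2
        + ((4 * ε)⁻¹ * ε ^ 2) • (1 : R) - (4 * ε)⁻¹ • r ^ 2 + (3 / 4 * ε) • (1 : R) := by
        rw [e1, e2, e3]
        algebra
    _ = _ := by algebra

/-- The product of a positive element with a *bounded* positive element is positive. -/
theorem mul_nonneg_of_bounded {p q : R} {r : ℝ} (hp : 0 ≤ p) (hq : 0 ≤ q) (hqr : q ≤ r • (1 : R)) :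
    0 ≤ p * q := by
  obtain ⟨s, hs, hrs⟩ : ∃ s : ℝ, 0 < s ∧ r ≤ s := ⟨max r 1, by positivity, le_max_left _ _⟩
  have h : q ≤ s • (1 : R) := hqr.trans (smul_one_mono hrs)
  have h1 : s⁻¹ • q ≤ 1 := by
    have := smul_le_smul_of_nonneg_left h (inv_nonneg.2 hs.le)
    rwa [inv_smul_smul₀ hs.ne'] at this
  have h2 := mul_nonneg_of_le_one hp (smul_nonneg (inv_nonneg.2 hs.le) hq) h1
  rw [mul_smul_comm] at h2
  exact nonneg_of_smul_nonneg (inv_pos.2 hs) h2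

theorem IsMajorized.add {x y : R} {r s : ℝ} (hx : IsMajorized x r) (hy : IsMajorized y s) :
    IsMajorized (x + y) (r + s) :=
  ⟨add_nonneg hx.1 hy.1, add_nonneg hx.2.1 hy.2.1, by
    rw [add_smul]
    exact add_le_add hx.2.2 hy.2.2⟩

theorem IsMajorized.mul {x y : R} {r s : ℝ} (hx : IsMajorized x r) (hy : IsMajorized y s) :
    IsMajorized (x * y) (r * s) :=
  ⟨mul_nonneg hx.1 hy.1, mul_nonneg_of_bounded hx.2.1 hy.2.1 hy.2.2,
    le_of_sub_eq (add_nonneg (smul_nonneg hy.1 (sub_nonneg.2 hx.2.2))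
      (mul_nonneg_of_bounded (sub_nonneg.2 hy.2.2) hx.2.1 hx.2.2)) (by algebra)⟩

theorem AbsLE.neg {x : R} {r : ℝ} (hx : AbsLE x r) : AbsLE (-x) r :=
  ⟨neg_le_neg hx.2, neg_le.1 hx.1⟩

theorem AbsLE.add {x y : R} {r s : ℝ} (hx : AbsLE x r) (hy : AbsLE y s) : AbsLE (x + y) (r + s) :=
  ⟨by rw [add_smul, neg_add]; exact add_le_add hx.1 hy.1,
    by rw [add_smul]; exact add_le_add hx.2 hy.2⟩

theorem AbsLE.mul_isMajorized {x y : R} {r s : ℝ} (hr : 0 ≤ r) (hx : AbsLE x r)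
    (hy : IsMajorized y s) : AbsLE (x * y) (r * s) := by
  have key : ∀ x : R, x ≤ r • (1 : R) → x * y ≤ (r * s) • (1 : R) := fun x hx =>
    le_of_sub_eq (add_nonneg (smul_nonneg hr (sub_nonneg.2 hy.2.2))
      (mul_nonneg_of_bounded (sub_nonneg.2 hx) hy.2.1 hy.2.2)) (by algebra)
  refine ⟨?_, key x hx.2⟩
  have := key (-x) hx.neg.2
  rw [neg_mul] at this
  exact neg_le.1 this

theorem AbsLE.sq_le {x : R} {r : ℝ} (hx : AbsLE x r) : x ^ 2 ≤ (r ^ 2) • (1 : R) := by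
  have h1 : 0 ≤ r • (1 : R) - x := sub_nonneg.2 hx.2
  have h2 : 0 ≤ r • (1 : R) + x := by simpa [add_comm] using sub_nonneg.2 hx.1
  have h3 : r • (1 : R) + x ≤ (2 * r) • (1 : R) := le_of_sub_eq h1 (by algebra)
  exact le_of_sub_eq (mul_nonneg_of_bounded h1 h2 h3) (by algebra)

/-- Multiplying a small element by a fixed, possibly unbounded, element `a` gives a result that is
small relative to `a ^ 2 + 1`. -/
theorem AbsLE.two_mul_mul_le {x : R} {r : ℝ} (hr : 0 < r) (hx : AbsLE x r) (a : R) :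
    2 * (a * x) ≤ r • (a ^ 2 + 1) := by
  have h1 := smul_nonneg hr.le (sq_nonneg_of_squareOrdered (a - r⁻¹ • x))
  have h2 := smul_nonneg (inv_nonneg.2 hr.le) (sub_nonneg.2 (hx.sq_le))
  refine le_of_sub_eq (add_nonneg h1 h2) ?_
  have e1 : r * r⁻¹ = 1 := mul_inv_cancel₀ hr.ne'
  have e2 : r * r⁻¹ ^ 2 = r⁻¹ := by field_simp
  have e3 : r⁻¹ * r ^ 2 = r := by field_simp
  calc r • (a ^ 2 + 1) - 2 * (a * x)
      = r • a ^ 2 + r • (1 : R) - (2 : R) * ((1 : ℝ) • (a * x)) := by algebra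
    _ = r • a ^ 2 + (r⁻¹ * r ^ 2) • (1 : R) - (2 : R) * ((r * r⁻¹) • (a * x))
        + (r * r⁻¹ ^ 2) • x ^ 2 - r⁻¹ • x ^ 2 := by
        rw [e1, e2, e3]
        algebra
    _ = _ := by algebra

end Commutative

section CommutativeComplete

variable {R : Type*} [CommRing R] [Algebra ℝ R] [PartialOrder R] [IsArchimedeanSquareOrdered R]

open IsArchimedeanSquareOrdered

/-! ### Square roots and inverses of bounded elements -/

/-- The fixed point iteration for `p ↦ a + b * p + c * p ^ 2` with positive bounded coefficients
converges as soon as a scalar majorant of it stays bounded: the increments of the iteration are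
majorized by those of the bounded monotone scalar iteration. -/
theorem exists_fixedPoint (hR : IsOrderUnitComplete R) {a b c : R} {α β γ T : ℝ}
    (ha : IsMajorized a α) (hb : IsMajorized b β) (hc : IsMajorized c γ) (hT0 : 0 ≤ T)
    (hT : α + β * T + γ * T ^ 2 ≤ T) :
    ∃ p : R, 0 ≤ p ∧ p ≤ T • (1 : R) ∧ a + b * p + c * p ^ 2 = p := by
  let p : ℕ → R := fun n => Nat.rec 0 (fun _ p => a + b * p + c * p ^ 2) n
  let t : ℕ → ℝ := fun n => Nat.rec 0 (fun _ t => α + β * t + γ * t ^ 2) n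
  have hp : ∀ n, p (n + 1) = a + b * p n + c * p n ^ 2 := fun n => rfl
  have ht : ∀ n, t (n + 1) = α + β * t n + γ * t n ^ 2 := fun n => rfl
  have hα := ha.1
  have hβ := hb.1
  have hγ := hc.1
  have inv : ∀ n, IsMajorized (p n) (t n) ∧ t n ≤ T ∧
      IsMajorized (p (n + 1) - p n) (t (n + 1) - t n) := by
    intro n
    induction n with
    | zero =>
      have hp0 : p 0 = 0 := rfl
      have ht0 : t 0 = 0 := rfl
      refine ⟨?_, by simpa [ht0] using hT0, ?_⟩
      · rw [hp0, ht0]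
        exact ⟨le_rfl, le_rfl, by simp⟩
      · simpa [hp, ht, hp0, ht0] using ha
    | succ n ih =>
      obtain ⟨h1, h2, h3⟩ := ih
      have h4 : IsMajorized (p (n + 1)) (t (n + 1)) := by
        simpa using h3.add h1
      refine ⟨h4, ?_, ?_⟩
      · rw [ht]
        refine le_trans ?_ hT
        have := h1.1
        gcongr
      · have h5 := (hb.mul h3).add (hc.mul (h3.mul (h4.add h1)))
        convert h5 using 1
        · rw [hp (n + 1), hp n]
          ring
        · rw [ht (n + 1), ht n]
          ring
  have mono_t : Monotone t := monotone_nat_of_le_succ fun n => sub_nonneg.1 (inv n).2.2.1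
  have mono_p : Monotone p := monotone_nat_of_le_succ fun n => sub_nonneg.1 (inv n).2.2.2.1
  have mono_tp : Monotone fun n => t n • (1 : R) - p n := monotone_nat_of_le_succ fun n =>
    le_of_sub_eq (sub_nonneg.2 (inv n).2.2.2.2) (by rw [sub_smul]; abel)
  have conv : CauchySeq t :=
    (tendsto_atTop_ciSup mono_t ⟨T, by rintro _ ⟨n, rfl⟩; exact (inv n).2.1⟩).cauchySeq
  obtain ⟨l, hl⟩ := hR p fun ε hε => by
    obtain ⟨N, hN⟩ := Metric.cauchySeq_iff.1 conv ε hε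
    refine ⟨N, fun m n hm hn => ?_⟩
    rcases le_total n m with h | h
    · refine le_trans (b := (t m - t n) • (1 : R)) ?_ (smul_one_mono ?_)
      · exact le_of_sub_eq (sub_nonneg.2 (mono_tp h)) (by simp only [sub_smul]; abel)
      · exact (le_abs_self _).trans (hN m hm n hn).le
    · exact (sub_nonpos.2 (mono_p h)).trans (smul_nonneg hε.le one_nonneg)
  have hl0 : 0 ≤ l := nonneg_of_forall_neg_smul_le (w := 1) fun ε hε => by
    obtain ⟨N, hN⟩ := hl ε hε
    exact le_of_sub_eq (add_nonneg (inv N).1.2.1 (sub_nonneg.2 (hN N le_rfl).2)) (by abel)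
  have hlT : l ≤ T • (1 : R) := by
    rw [← sub_nonneg]
    refine nonneg_of_forall_neg_smul_le (w := 1) fun ε hε => ?_
    obtain ⟨N, hN⟩ := hl ε hε
    have h1 : p N ≤ T • (1 : R) := (inv N).1.2.2.trans (smul_one_mono (inv N).2.1)
    exact le_of_sub_eq (add_nonneg (sub_nonneg.2 h1) (sub_nonneg.2 (hN N le_rfl).1)) (by abel)
  refine ⟨l, hl0, hlT, ?_⟩
  rw [← sub_eq_zero]
  refine eq_zero_of_forall_abs_le_smul (w := (β + γ * (T + T) + 1) • (1 : R)) fun ε hε => ?_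
  obtain ⟨N, hN⟩ := hl ε hε
  have e1 := (hN N le_rfl).neg
  have e2 := hN (N + 1) (Nat.le_succ N)
  have hpl : IsMajorized (l + p N) (T + T) :=
    IsMajorized.add ⟨hT0, hl0, hlT⟩
      ⟨hT0, (inv N).1.2.1, (inv N).1.2.2.trans (smul_one_mono (inv N).2.1)⟩
  have h := (e1.mul_isMajorized hε.le (hb.add (hc.mul hpl))).add e2
  have e3 : -(p N - l) * (b + c * (l + p N)) + (p (N + 1) - l) = a + b * l + c * l ^ 2 - l := by
    rw [hp]
    ring
  rw [e3] at h
  have e4 : ε • ((β + γ * (T + T) + 1) • (1 : R)) =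
      (ε * (β + γ * (T + T)) + ε) • (1 : R) := by
    rw [smul_smul]
    congr 1
    ring
  rw [e4]
  exact h

/-- The square root of `b` is `1 - p`, where `p` solves `p = ((1 - b) + p ^ 2) / 2`. -/
theorem exists_sqrt_of_le_one (hR : IsOrderUnitComplete R) {b : R} (h0 : 0 ≤ b) (h1 : b ≤ 1) :
    ∃ s : R, 0 ≤ s ∧ s ≤ 1 ∧ s ^ 2 = b := by
  have half : (0 : ℝ) ≤ 1 / 2 := by norm_num
  have ha : IsMajorized ((1 / 2 : ℝ) • (1 - b)) (1 / 2) :=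
    ⟨half, smul_nonneg half (sub_nonneg.2 h1),
      smul_le_smul_of_nonneg_left (sub_le_self _ h0) half⟩
  have hb : IsMajorized (0 : R) 0 := ⟨le_rfl, le_rfl, by simp⟩
  have hc : IsMajorized ((1 / 2 : ℝ) • (1 : R)) (1 / 2) :=
    ⟨half, smul_nonneg half one_nonneg, le_rfl⟩
  obtain ⟨p, hp0, hp1, hp⟩ := exists_fixedPoint hR ha hb hc zero_le_one (by norm_num)
  refine ⟨1 - p, sub_nonneg.2 (by simpa using hp1), sub_le_self _ hp0, ?_⟩
  have h2 : (2 : ℝ) • ((1 / 2 : ℝ) • (1 - b) + 0 * p + (1 / 2 : ℝ) • (1 : R) * p ^ 2) =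
      (1 - b) + p ^ 2 := by algebra
  rw [hp] at h2
  have h3 : (2 : ℝ) • p = p + p := two_smul ℝ p
  linear_combination h3 - h2

/-- The inverse is given by the Neumann series, obtained as the solution of
`p = 1 + (1 - C⁻¹ x) * p`. -/
theorem exists_inv_of_bounded (hR : IsOrderUnitComplete R) {x : R} {ε C : ℝ} (hε : 0 < ε)
    (hx : ε • (1 : R) ≤ x) (hxC : x ≤ C • (1 : R)) : ∃ z : R, 0 ≤ z ∧ x * z = 1 := by
  obtain ⟨D, hεD, hCD⟩ : ∃ D : ℝ, ε ≤ D ∧ C ≤ D := ⟨max ε C, le_max_left _ _, le_max_right _ _⟩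
  have hD : 0 < D := hε.trans_le hεD
  have hxD : x ≤ D • (1 : R) := hxC.trans (smul_one_mono hCD)
  have hDi : 0 ≤ D⁻¹ := (inv_pos.2 hD).le
  have e1 : D⁻¹ • (D • (1 : R)) = 1 := inv_smul_smul₀ hD.ne' _
  have ha : IsMajorized (1 : R) 1 := ⟨zero_le_one, one_nonneg, by simp⟩
  have hb : IsMajorized (1 - D⁻¹ • x) (1 - D⁻¹ * ε) := by
    refine ⟨?_, ?_, ?_⟩
    · rw [sub_nonneg, inv_mul_le_iff₀ hD]
      simpa using hεD
    · have := smul_le_smul_of_nonneg_left hxD hDi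
      rw [e1] at this
      exact sub_nonneg.2 this
    · have := smul_le_smul_of_nonneg_left hx hDi
      rw [sub_smul, mul_smul, one_smul]
      exact sub_le_sub_left this _
  have hc : IsMajorized (0 : R) 0 := ⟨le_rfl, le_rfl, by simp⟩
  obtain ⟨p, hp0, -, hp⟩ := exists_fixedPoint hR ha hb hc (T := D / ε) (by positivity)
    (by field_simp; linarith)
  refine ⟨D⁻¹ • p, smul_nonneg hDi hp0, ?_⟩
  have e2 : x * D⁻¹ • p = (D⁻¹ • x) * p := by algebra
  rw [e2]
  linear_combination -hp

/-! ### Inverses and square roots of unbounded elements -/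

/-- A coercive element `a` is invertible if `a ^ 2 + 1` is: with `h = (a ^ 2 + 1)⁻¹` and `k = a * h`,
both bounded, `k ≥ ε h` gives `h - h ^ 2 = k ^ 2 ≥ ε ^ 2 h ^ 2`, which keeps `h` away from `1`, so
that `a ^ 2 * h = 1 - h` has an inverse. -/
theorem isUnit_of_sq_add_one_inv (hR : IsOrderUnitComplete R) {a h : R} {ε : ℝ} (hε : 0 < ε)
    (ha : ε • (1 : R) ≤ a) (hh : (a ^ 2 + 1) * h = 1) : IsUnit a := by
  have h0 : 0 ≤ h := by
    have h1 := sq_mul_nonneg h (add_nonneg (sq_nonneg_of_squareOrdered a) one_nonneg)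
    rwa [show h ^ 2 * (a ^ 2 + 1) = h by linear_combination h * hh] at h1
  have hk : (a * h) ^ 2 = h - h ^ 2 := by linear_combination h * hh
  have hh1 : h ≤ 1 := le_one_of_sq_le (by
    rw [← sub_nonneg, ← hk]
    exact sq_nonneg_of_squareOrdered _)
  have hk1 : a * h ≤ 1 := by
    have h1 : 0 ≤ (2 : ℝ) • (1 - a * h) := by
      have := add_nonneg (add_nonneg (sq_nonneg_of_squareOrdered (1 - a * h)) (sub_nonneg.2 hh1))
        (sq_nonneg_of_squareOrdered h)
      convert this using 1
      rw [two_smul]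
      linear_combination -hk
    exact sub_nonneg.1 (nonneg_of_smul_nonneg two_pos h1)
  have hk2 : 0 ≤ a * h - ε • h := by
    have := mul_nonneg_of_le_one (sub_nonneg.2 ha) h0 hh1
    rwa [sub_mul, smul_mul_assoc, one_mul] at this
  have hεh : 0 ≤ ε • h := smul_nonneg hε.le h0
  have hk3 : 0 ≤ (a * h + ε • h) * (a * h - ε • h) := by
    refine mul_nonneg_of_le_one ?_ hk2 ((sub_le_self _ hεh).trans hk1)
    exact le_of_sub_eq (add_nonneg hk2 (add_nonneg hεh hεh)) (by abel)
  have hg : (1 + ε ^ 2) • h ≤ 1 := by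
    refine le_one_of_sq_le (le_of_sub_eq
      (smul_nonneg (by positivity : 0 ≤ 1 + ε ^ 2) hk3) ?_)
    have e : (a * h + ε • h) * (a * h - ε • h) = (h - h ^ 2) - (ε ^ 2) • h ^ 2 := by
      rw [← hk]
      algebra
    rw [e]
    algebra
  have hco : (ε ^ 2 / (1 + ε ^ 2)) • (1 : R) ≤ 1 - h := by
    have := smul_nonneg (by positivity : 0 ≤ (1 + ε ^ 2)⁻¹) (sub_nonneg.2 hg)
    refine le_of_sub_eq this ?_
    have e : ε ^ 2 / (1 + ε ^ 2) = 1 - (1 + ε ^ 2)⁻¹ := by field_simp; ring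
    rw [e, smul_sub, smul_smul, inv_mul_cancel₀ (by positivity), sub_smul, one_smul, one_smul]
    abel
  obtain ⟨z, -, hz⟩ := exists_inv_of_bounded hR (C := 1) (by positivity) hco
    (by simpa using h0)
  exact IsUnit.of_mul_eq_one (a * h * z) (by linear_combination hz + z * hh)

/-- The inverse of a coercive element is positive and bounded. -/
theorem inv_of_coercive_bounds {a c : R} {ε : ℝ} (hε : 0 < ε) (ha : ε • (1 : R) ≤ a)
    (hc : a * c = 1) : 0 ≤ c ∧ c ≤ ε⁻¹ • (1 : R) := by
  have ha0 : 0 ≤ a := (smul_nonneg hε.le one_nonneg).trans ha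
  have h1 : ε • c ≤ 1 := by
    refine le_one_of_sq_le (le_of_sub_eq (smul_nonneg hε.le (sq_mul_nonneg c (sub_nonneg.2 ha))) ?_)
    have e : c ^ 2 * (a - ε • (1 : R)) = c - ε • c ^ 2 := by
      rw [mul_sub, mul_smul_comm, mul_one]
      linear_combination c * hc
    rw [e]
    algebra
  refine ⟨?_, ?_⟩
  · have := sq_mul_nonneg c ha0
    rwa [show c ^ 2 * a = c by linear_combination c * hc] at this
  · have := smul_le_smul_of_nonneg_left h1 (inv_pos.2 hε).le
    rwa [inv_smul_smul₀ hε.ne'] at this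

theorem nonneg_of_mul_nonneg_of_inv {a b c : R} {ε : ℝ} (hε : 0 < ε) (ha : ε • (1 : R) ≤ a)
    (hc : a * c = 1) (hab : 0 ≤ a * b) : 0 ≤ b := by
  obtain ⟨h1, h2⟩ := inv_of_coercive_bounds hε ha hc
  have := mul_nonneg_of_bounded hab h1 h2
  rwa [show a * b * c = b by linear_combination b * hc] at this

/-- With the bounded element `b = (1 + a)⁻¹`, the square root of `a = (1 - b) * b⁻¹` is
`√(1 - b) * (√b)⁻¹`. -/
theorem exists_sqrt_of_inv (hR : IsOrderUnitComplete R) {a b : R} (ha : 0 ≤ a)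
    (hb : (1 + a) * b = 1) : ∃ x : R, 0 ≤ x ∧ x ^ 2 = a := by
  obtain ⟨hb0, hb1⟩ := inv_of_coercive_bounds one_pos (by simpa using ha) hb
  have hb1' : b ≤ 1 := by simpa using hb1
  obtain ⟨s, hs0, hs1, hs⟩ := exists_sqrt_of_le_one hR hb0 hb1'
  obtain ⟨t, ht0, -, ht⟩ := exists_sqrt_of_le_one hR (sub_nonneg.2 hb1') (sub_le_self _ hb0)
  refine ⟨t * (s * (1 + a)), ?_, ?_⟩
  · have h1 := sq_mul_nonneg (s * (1 + a)) (mul_nonneg_of_le_one ht0 hs0 hs1)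
    convert h1 using 1
    linear_combination (-t * s * (1 + a) ^ 2) * hs - (t * s * (1 + a)) * hb
  · linear_combination (s ^ 2 * (1 + a) ^ 2) * ht + ((1 - b) * (1 + a) ^ 2) * hs +
      ((1 + a) * (1 - b) - 1) * hb

/-! ### Inverses from the truncations of an element -/

/-- The hypothesis `hrad` says that `R` is radical. Two elements with vanishing product and positive
sum are then positive (the statement being symmetric in `u` and `v`); radicality is applied to the
coercive element `u + v + 4 ε` and to `v + ε`. -/
theorem nonneg_of_mul_eq_zero
    (hrad : ∀ (a b : R) (ε : ℝ), 0 < ε → ε • (1 : R) ≤ a → 0 ≤ a * b → 0 ≤ b)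
    {u v : R} (huv : u * v = 0) (hs : 0 ≤ u + v) : 0 ≤ v := by
  refine nonneg_of_forall_neg_smul_le (w := 1) fun ε hε => ?_
  have h1 : (4 * ε) • (1 : R) ≤ u + v + (4 * ε) • (1 : R) := le_add_of_nonneg_left hs
  have h2 := hrad _ (v + ε • (1 : R)) (4 * ε) (by positivity) h1 <| by
    -- the product is `(v + 2 ε) ^ 2 + ε (u + v)`
    have := add_nonneg (sq_nonneg_of_squareOrdered (v + (2 * ε) • (1 : R))) (smul_nonneg hε.le hs)
    refine this.trans_eq ?_
    have e : (u + v + (4 * ε) • (1 : R)) * (v + ε • (1 : R)) =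
      u * v + ((v + (2 * ε) • (1 : R)) ^ 2 + ε • (u + v)) := by algebra
    rw [e, huv, zero_add]
  exact le_of_sub_eq h2 (by abel)

/-- If `x` satisfies the algebraic identity and the inequality of `a ∧ r` for a coercive `a` and a
constant `r ≥ 1`, then it is a coercive lower bound of `a` and `r`. -/
theorem bounds_of_wedge
    (hrad : ∀ (a b : R) (ε : ℝ), 0 < ε → ε • (1 : R) ≤ a → 0 ≤ a * b → 0 ≤ b)
    {a x : R} {ε r : ℝ} (ha : ε • (1 : R) ≤ a) (hε : ε ≤ 1 / 2) (hr : 1 ≤ r)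
    (hx : (a - x) * (r • (1 : R) - x) = 0) (hx2 : 0 ≤ (a - x) + (r • (1 : R) - x)) :
    x ≤ a ∧ x ≤ r • (1 : R) ∧ ε • (1 : R) ≤ x := by
  refine ⟨?_, ?_, ?_⟩
  · exact sub_nonneg.1 (nonneg_of_mul_eq_zero hrad (by rw [mul_comm]; exact hx)
      (by rw [add_comm]; exact hx2))
  · exact sub_nonneg.1 (nonneg_of_mul_eq_zero hrad hx hx2)
  · rw [← sub_nonneg]
    refine hrad ((a - ε • (1 : R)) + (r - ε) • (1 : R)) _ (r - ε) (by linarith)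
      (le_add_of_nonneg_left (sub_nonneg.2 ha)) ?_
    refine (add_nonneg (sq_nonneg_of_squareOrdered (x - ε • (1 : R)))
      (smul_nonneg (by linarith : 0 ≤ r - ε) (sub_nonneg.2 ha))).trans_eq ?_
    have e : (a - ε • (1 : R) + (r - ε) • (1 : R)) * (x - ε • (1 : R)) =
        (x - ε • (1 : R)) ^ 2 + (r - ε) • (a - ε • (1 : R)) - (a - x) * (r • (1 : R) - x) := by
      algebra
    rw [e, hx, sub_zero]

/-- The inverses `z` and `w` of the truncations `x = a ∧ r` and `y = a ∧ s` satisfy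
`z ≤ w + r⁻¹`. -/
theorem inv_wedge_le
    (hrad : ∀ (a b : R) (ε : ℝ), 0 < ε → ε • (1 : R) ≤ a → 0 ≤ a * b → 0 ≤ b)
    {a x y z w : R} {ε r : ℝ} (hε : 0 < ε) (hr : 0 < r) (hx0 : ε • (1 : R) ≤ x)
    (hy0 : ε • (1 : R) ≤ y) (hxr : x ≤ r • (1 : R)) (hya : y ≤ a)
    (hx : (a - x) * (r • (1 : R) - x) = 0) (hz : x * z = 1) (hw : y * w = 1) :
    z - w ≤ r⁻¹ • (1 : R) := by
  have hx' : 0 ≤ x := (smul_nonneg hε.le one_nonneg).trans hx0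
  -- `z - r⁻¹` is a multiple of `r - x`, hence annihilated by `a - x`
  have hd : z - r⁻¹ • (1 : R) = r⁻¹ • (z * (r • (1 : R) - x)) := by
    have e : z * (r • (1 : R) - x) = r • z - 1 := by
      rw [mul_sub, mul_smul_comm, mul_one]
      linear_combination -hz
    rw [e, smul_sub, inv_smul_smul₀ hr.ne']
  have h1 : (z - r⁻¹ • (1 : R)) * (a - x) = 0 := by
    rw [hd, smul_mul_assoc, show z * (r • (1 : R) - x) * (a - x) =
      z * ((a - x) * (r • (1 : R) - x)) by ring, hx, mul_zero, smul_zero]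
  have h2 : 0 ≤ (z - r⁻¹ • (1 : R)) * (a - y) := by
    refine hrad x _ ε hε hx0 ?_
    have h3 := smul_nonneg (inv_pos.2 hr).le (mul_nonneg_of_bounded (sub_nonneg.2 hya)
      (sub_nonneg.2 hxr) (sub_le_self _ hx'))
    convert h3 using 1
    rw [hd, smul_mul_assoc, mul_smul_comm]
    congr 1
    linear_combination ((r • (1 : R) - x) * (a - y)) * hz
  have h4 : 0 ≤ w - (z - r⁻¹ • (1 : R)) := by
    refine hrad y _ ε hε hy0 ?_
    have h5 := add_nonneg h2 (smul_nonneg (inv_pos.2 hr).le hx')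
    convert h5 using 1
    have e : (r⁻¹ • (1 : R)) * x = r⁻¹ • x := by algebra
    rw [← e]
    linear_combination hw - hz - h1
  exact le_of_sub_eq h4 (by abel)

/-- If all truncations `x n = a ∧ (n + 1)` of a coercive element `a` exist, then `a` is invertible:
the inverses of the truncations form a Cauchy sequence whose limit is the inverse of `a`. -/
theorem isUnit_of_forall_wedge (hR : IsOrderUnitComplete R)
    (hrad : ∀ (a b : R) (ε : ℝ), 0 < ε → ε • (1 : R) ≤ a → 0 ≤ a * b → 0 ≤ b)
    {a : R} {ε : ℝ} (hε : 0 < ε) (ha : ε • (1 : R) ≤ a)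
    (hx : ∀ n : ℕ, ∃ x : R, (a - x) * ((n + 1 : ℝ) • (1 : R) - x) = 0 ∧
      0 ≤ (a - x) + ((n + 1 : ℝ) • (1 : R) - x)) : IsUnit a := by
  wlog hε2 : ε ≤ 1 / 2 generalizing ε
  · refine this (ε := 1 / 2) (by norm_num) ((smul_one_mono ?_).trans ha) le_rfl
    linarith
  choose x hx1 hx2 using hx
  have hr : ∀ n : ℕ, (1 : ℝ) ≤ n + 1 := fun n => by simp
  have hb := fun n => bounds_of_wedge hrad ha hε2 (hr n) (hx1 n) (hx2 n)
  choose z hz0 hz using fun n => exists_inv_of_bounded hR hε (hb n).2.2 (hb n).2.1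
  have hzz : ∀ m n : ℕ, z m - z n ≤ (m + 1 : ℝ)⁻¹ • (1 : R) := fun m n =>
    inv_wedge_le hrad hε (by positivity) (hb m).2.2 (hb n).2.2 (hb m).2.1 (hb n).1 (hx1 m)
      (hz m) (hz n)
  have small : ∀ δ : ℝ, 0 < δ → ∃ N : ℕ, ∀ n : ℕ, N ≤ n → (n + 1 : ℝ)⁻¹ ≤ δ := fun δ hδ => by
    obtain ⟨N, hN⟩ := exists_nat_one_div_lt hδ
    refine ⟨N, fun n hn => le_trans ?_ hN.le⟩
    rw [← one_div]
    gcongr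
  obtain ⟨l, hl⟩ := hR z fun δ hδ => by
    obtain ⟨N, hN⟩ := small δ hδ
    exact ⟨N, fun m n hm _ => (hzz m n).trans (smul_one_mono (hN m hm))⟩
  refine IsUnit.of_mul_eq_one l (sub_eq_zero.1 ?_)
  refine eq_zero_of_forall_abs_le_smul (w := a ^ 2 + 1) fun η hη => ?_
  obtain ⟨N1, hN1⟩ := hl η hη
  obtain ⟨N2, hN2⟩ := small η hη
  obtain ⟨n, hn1, hn2⟩ : ∃ n, N1 ≤ n ∧ N2 ≤ n := ⟨max N1 N2, le_max_left _ _, le_max_right _ _⟩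
  have hd := hN1 n hn1
  have hs := hN2 n hn2
  have hi : (0 : ℝ) ≤ (n + 1 : ℝ)⁻¹ := by positivity
  have hxa : 0 ≤ a - x n := sub_nonneg.2 (hb n).1
  have hx0 : 0 ≤ x n := (smul_nonneg hε.le one_nonneg).trans (hb n).2.2
  -- the error of `z n` as an inverse of `a`
  have herr : a * z n - 1 = (n + 1 : ℝ)⁻¹ • (a - x n) := by
    have e1 : (n + 1 : ℝ) • (a * z n - 1) = a - x n := by
      have e2 : (n + 1 : ℝ) • (a * z n - 1) =
          (n + 1 : ℝ) • (1 : R) * a * z n - (n + 1 : ℝ) • (1 : R) := by algebra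
      rw [e2]
      linear_combination z n * hx1 n + (a + (n + 1 : ℝ) • (1 : R) - x n) * hz n
    rw [← e1, inv_smul_smul₀ (by positivity)]
  have h2a : 2 * (a - x n) ≤ a ^ 2 + 1 :=
    le_of_sub_eq (add_nonneg (sq_nonneg_of_squareOrdered (a - 1)) (add_nonneg hx0 hx0)) (by ring)
  have hup := hd.neg.two_mul_mul_le hη a
  have hlo := hd.two_mul_mul_le hη a
  have ha1 : 0 ≤ a ^ 2 + 1 := add_nonneg (sq_nonneg_of_squareOrdered a) one_nonneg
  have herr0 : 0 ≤ a * z n - 1 := herr ▸ smul_nonneg hi hxa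
  have herr1 : 2 * (a * z n - 1) ≤ η • (a ^ 2 + 1) := by
    rw [herr, mul_smul_comm]
    exact (smul_le_smul_of_nonneg_left h2a hi).trans (smul_le_smul_of_nonneg_right hs ha1)
  refine ⟨?_, ?_⟩
  · refine le_of_sub_eq (nonneg_of_smul_nonneg two_pos (x := a * l - 1 - -(η • (a ^ 2 + 1))) ?_) rfl
    refine (add_nonneg (add_nonneg (add_nonneg (sub_nonneg.2 hlo) herr0) herr0)
      (smul_nonneg hη.le ha1)).trans_eq ?_
    rw [two_smul]
    ring
  · refine le_of_sub_eq (nonneg_of_smul_nonneg two_pos (x := η • (a ^ 2 + 1) - (a * l - 1)) ?_) rfl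
    refine (add_nonneg (sub_nonneg.2 hup) (sub_nonneg.2 herr1)).trans_eq ?_
    rw [two_smul]
    ring

end CommutativeComplete

section Bicommutant

variable {A : Type*} [Ring A]

/-! ### Bicommutants of commuting elements -/

theorem commute_of_mem_bicommutant {S : Set A} (hcomm : ∀ s ∈ S, ∀ t ∈ S, s * t = t * s) {x y : A}
    (hx : x ∈ bicommutant S) (hy : y ∈ bicommutant S) : x * y = y * x :=
  hy x fun s hs => hx s fun t ht => hcomm t ht s hs

theorem subset_bicommutant (S : Set A) : S ⊆ bicommutant S := Set.subset_centralizer_centralizer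

theorem bicommutant_subset_bicommutant {S T : Set A} (h : T ⊆ bicommutant S) :
    bicommutant T ⊆ bicommutant S :=
  fun _ hx c hc => hx c fun _ ht => (h ht c hc).symm

theorem mul_comm_of_mem_pair {a b : A} (h : Commute a b) :
    ∀ s ∈ ({a, b} : Set A), ∀ t ∈ ({a, b} : Set A), s * t = t * s := by
  rintro s (rfl | rfl) t (rfl | rfl)
  exacts [rfl, h, h.symm, rfl]

theorem mul_comm_of_mem_singleton (a : A) :
    ∀ s ∈ ({a} : Set A), ∀ t ∈ ({a} : Set A), s * t = t * s := by
  rintro s rfl t rfl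
  rfl

theorem smul_mem_bicommutant [Algebra ℂ A] {S : Set A} {x : A} (r : ℝ) (hx : x ∈ bicommutant S) :
    r • x ∈ bicommutant S := fun c hc => by
  rw [mul_smul_comm, smul_mul_assoc, hx c hc]

theorem isUnit_add_I_and_sub_I_iff [Algebra ℂ A] (a : A) :
    (IsUnit (a + Complex.I • (1 : A)) ∧ IsUnit (a - Complex.I • (1 : A))) ↔ IsUnit (a ^ 2 + 1) := by
  have hc : Commute (a + Complex.I • (1 : A)) (a - Complex.I • (1 : A)) :=
    ((Commute.refl a).sub_right ((Commute.one_right a).smul_right _)).add_left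
      (((Commute.one_left _).smul_left _))
  rw [← hc.isUnit_mul_iff]
  have e : (a + Complex.I • (1 : A)) * (a - Complex.I • (1 : A)) = a ^ 2 + 1 := by
    rw [mul_sub, add_mul, add_mul, smul_mul_smul_comm, Complex.I_mul_I, mul_smul_comm,
      smul_mul_assoc, ← sq, mul_one, mul_one, one_mul, neg_smul, one_smul]
    abel
  rw [e]

theorem isSelfAdjoint_of_mem_singleton [StarRing A] (a : selfAdjoint A) :
    ∀ s ∈ ({(a : A)} : Set A), IsSelfAdjoint s := by
  rintro s rfl
  exact a.2

end Bicommutant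

section HermitianBicommutant

open scoped ComplexStarModule

variable {A : Type*} [Ring A] [StarRing A] [Algebra ℂ A] [StarModule ℂ A]

/-! ### The Hermitian part of a bicommutant -/

/-- The Hermitian elements of the bicommutant of a set of pairwise commuting elements, as a real
subalgebra. It is closed under products because the bicommutant is commutative. -/
def hermitianBicommutant (S : Set A)
    (hcomm : ∀ s ∈ S, ∀ t ∈ S, s * t = t * s) : Subalgebra ℝ A where
  carrier := {x | IsSelfAdjoint x ∧ x ∈ bicommutant S}
  mul_mem' {x y} hx hy := by
    refine ⟨(IsSelfAdjoint.commute_iff hx.1 hy.1).1 (commute_of_mem_bicommutant hcomm hx.2 hy.2), ?_⟩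
    exact Set.mul_mem_centralizer hx.2 hy.2
  add_mem' hx hy := ⟨hx.1.add hy.1, Set.add_mem_centralizer hx.2 hy.2⟩
  algebraMap_mem' r := by
    refine ⟨?_, fun c _ => (Algebra.commutes r c).symm⟩
    rw [Algebra.algebraMap_eq_smul_one]
    exact (IsSelfAdjoint.all r).smul (IsSelfAdjoint.one A)

section Instances

variable {S : Set A} {hcomm : ∀ s ∈ S, ∀ t ∈ S, s * t = t * s}

instance : CommRing (hermitianBicommutant S hcomm) :=
  { (inferInstance : Ring (hermitianBicommutant S hcomm)) with
    mul_comm := fun x y => Subtype.ext (commute_of_mem_bicommutant hcomm x.2.2 y.2.2) }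

/-- An element of `hermitianBicommutant S` as a Hermitian element. -/
def toSelfAdjoint (x : hermitianBicommutant S hcomm) : selfAdjoint A := ⟨x, x.2.1⟩

theorem toSelfAdjoint_injective :
    Function.Injective (toSelfAdjoint : hermitianBicommutant S hcomm → selfAdjoint A) :=
  fun _ _ h => Subtype.ext (congrArg (fun y : selfAdjoint A => (y : A)) h)

instance [PartialOrder (selfAdjoint A)] : PartialOrder (hermitianBicommutant S hcomm) :=
  PartialOrder.lift toSelfAdjoint toSelfAdjoint_injective

/-- Elements of `hermitianBicommutant S` that are invertible in `A` have their inverse in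
`hermitianBicommutant S`. -/
theorem exists_mul_eq_one_of_isUnit {x : hermitianBicommutant S hcomm} (hx : IsUnit (x : A)) :
    ∃ z : hermitianBicommutant S hcomm, x * z = 1 := by
  obtain ⟨u, hu⟩ := hx
  have hs : star u = u := by
    ext
    rw [Units.coe_star, hu]
    exact x.2.1
  refine ⟨⟨(↑u⁻¹ : A), ?_, fun c hc => ?_⟩, Subtype.ext ?_⟩
  · rw [isSelfAdjoint_iff, ← Units.coe_star, star_inv, hs]
  · have h1 : Commute c (u : A) := by
      rw [hu]
      exact x.2.2 c hc
    exact h1.units_inv_right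
  · change (x : A) * ↑u⁻¹ = 1
    rw [← hu, Units.mul_inv]

theorem isUnit_coe {x : hermitianBicommutant S hcomm} (hx : IsUnit x) : IsUnit (x : A) :=
  hx.map (hermitianBicommutant S hcomm).val

end Instances

/-! ### The order and the uniform metric on Hermitian elements -/

section Order

variable [PartialOrder (selfAdjoint A)]

theorem uniformDist_le {a b : A} {r : ℝ} (hr : 0 < r)
    (h : starMulSelf (a - b) ≤ (r ^ 2) • (1 : selfAdjoint A)) : uniformDist a b ≤ r :=
  ENNReal.toReal_le_of_le_ofReal hr.le ((min_le_left _ _).trans (sInf_le ⟨r, hr, h, rfl⟩))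

theorem exists_of_uniformDist_lt {a b : A} {ε : ℝ} (hε1 : ε ≤ 1) (h : uniformDist a b < ε) :
    ∃ r : ℝ, 0 < r ∧ r < ε ∧ starMulSelf (a - b) ≤ (r ^ 2) • (1 : selfAdjoint A) := by
  have hfin : min (uniformNorm (a - b)) 1 ≠ ∞ :=
    ((min_le_right _ _).trans_lt ENNReal.one_lt_top).ne
  have h1 := (ENNReal.lt_ofReal_iff_toReal_lt hfin).2 h
  rcases min_lt_iff.1 h1 with h2 | h2
  · obtain ⟨t, ⟨r, hr, hle, rfl⟩, ht⟩ := sInf_lt_iff.1 h2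
    exact ⟨r, hr, (ENNReal.ofReal_lt_ofReal_iff_of_nonneg hr.le).1 ht, hle⟩
  · rw [ENNReal.one_lt_ofReal] at h2
    exact absurd hε1 h2.not_ge

variable [IsOrderedStarAlgebra A]

instance : IsOrderedAddMonoid (selfAdjoint A) where
  add_le_add_left a b h c := IsOrderedStarAlgebra.add_le_add_right a b c h

theorem conj_nonneg (d : A) {a : selfAdjoint A} (ha : 0 ≤ a) : 0 ≤ conj d a := by
  have h := IsOrderedStarAlgebra.conj_le_conj 0 a d ha
  rwa [show conj d (0 : selfAdjoint A) = 0 from Subtype.ext (by simp [conj])] at h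

theorem starMulSelf_nonneg (d : A) : 0 ≤ starMulSelf d := by
  have h := conj_nonneg d (IsOrderedStarAlgebra.zero_le_one (A := A))
  rwa [show conj d (1 : selfAdjoint A) = starMulSelf d from
    Subtype.ext (by simp [conj, starMulSelf])] at h

theorem selfAdjoint_smul_nonneg {r : ℝ} (hr : 0 ≤ r) {a : selfAdjoint A} (ha : 0 ≤ a) :
    0 ≤ r • a := by
  have h := conj_nonneg (√r • (1 : A)) ha
  rwa [show conj (√r • (1 : A)) a = r • a from Subtype.ext (by
    simp [conj, smul_smul, Real.mul_self_sqrt hr])] at h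

theorem selfAdjoint_nonneg_of_smul_nonneg {r : ℝ} (hr : 0 < r) {a : selfAdjoint A}
    (ha : 0 ≤ r • a) : 0 ≤ a := by
  have := selfAdjoint_smul_nonneg (inv_nonneg.2 hr.le) ha
  rwa [inv_smul_smul₀ hr.ne'] at this

theorem isArchimedeanSquareOrdered_hermitianBicommutant (hArch : IsArchimedean A) {S : Set A}
    (hcomm : ∀ s ∈ S, ∀ t ∈ S, s * t = t * s) :
    IsArchimedeanSquareOrdered (hermitianBicommutant S hcomm) where
  add_le_add_left a b h c :=
    IsOrderedStarAlgebra.add_le_add_right (toSelfAdjoint a) (toSelfAdjoint b) (toSelfAdjoint c) h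
  mul_self_mul_nonneg d c hc := by
    have h := conj_nonneg (d : A) (a := toSelfAdjoint c) hc
    rwa [show conj (d : A) (toSelfAdjoint c) = toSelfAdjoint (d * d * c) from Subtype.ext (by
      change star (d : A) * c * d = d * d * c
      rw [show star (d : A) = d from d.2.1, mul_assoc, mul_assoc,
        commute_of_mem_bicommutant hcomm c.2.2 d.2.2])] at h
  one_nonneg := IsOrderedStarAlgebra.zero_le_one (A := A)
  archimedean v w h := hArch (toSelfAdjoint v) (toSelfAdjoint w) h

/-- This expands `0 ≤ (r - d)⋆ (r - d)`. -/
theorem realPart_le_of_starMulSelf_le {d : A} {r : ℝ} (hr : 0 < r)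
    (h : starMulSelf d ≤ (r ^ 2) • (1 : selfAdjoint A)) : ℜ d ≤ r • (1 : selfAdjoint A) := by
  have h1 := add_nonneg (starMulSelf_nonneg (r • (1 : A) - d)) (sub_nonneg.2 h)
  refine sub_nonneg.1 (selfAdjoint_nonneg_of_smul_nonneg (show 0 < 2 * r by positivity) ?_)
  convert h1 using 1
  ext
  simp only [starMulSelf, realPart_apply_coe, selfAdjoint.val_smul, AddSubgroup.coe_sub,
    AddSubgroup.coe_add, selfAdjoint.val_one, star_sub, star_smul, star_one, star_trivial, sub_mul,
    mul_sub, smul_mul_assoc, mul_smul_comm, one_mul, mul_one]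
  module

theorem selfAdjoint_bounds_of_starMulSelf_le {d : A} {r : ℝ} (hr : 0 < r)
    (h : starMulSelf d ≤ (r ^ 2) • (1 : selfAdjoint A)) :
    -(r • (1 : selfAdjoint A)) ≤ ℜ d ∧ ℜ d ≤ r • (1 : selfAdjoint A) := by
  refine ⟨?_, realPart_le_of_starMulSelf_le hr h⟩
  rw [neg_le, ← map_neg]
  refine realPart_le_of_starMulSelf_le hr ?_
  rwa [show starMulSelf (-d) = starMulSelf d from Subtype.ext (by simp [starMulSelf])]

/-- In the commutative algebra of Hermitian elements of `{y}''`, this is `AbsLE.sq_le`. -/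
theorem starMulSelf_le_of_bounds (hArch : IsArchimedean A) {y : selfAdjoint A} {r : ℝ}
    (h1 : -(r • (1 : selfAdjoint A)) ≤ y) (h2 : y ≤ r • (1 : selfAdjoint A)) :
    starMulSelf (y : A) ≤ (r ^ 2) • (1 : selfAdjoint A) := by
  have hcomm := mul_comm_of_mem_singleton (y : A)
  have := isArchimedeanSquareOrdered_hermitianBicommutant hArch hcomm
  let x : hermitianBicommutant _ hcomm := ⟨y, y.2, fun c hc => (hc y rfl).symm⟩
  have hx : AbsLE x r := ⟨h1, h2⟩
  have h3 : toSelfAdjoint (x ^ 2) ≤ (r ^ 2) • (1 : selfAdjoint A) := hx.sq_le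
  rwa [show toSelfAdjoint (x ^ 2) = starMulSelf (y : A) from Subtype.ext (by
    change (y : A) ^ 2 = star (y : A) * y
    rw [sq, y.2.star_eq])] at h3

/-- The commutator of `c` with a small element is small relative to `c ^ 2 + 1`. This makes
commutation with an unbounded element stable under uniform limits. -/
theorem commutator_le {c y w : selfAdjoint A} {r : ℝ} (hr : 0 < r)
    (hy : starMulSelf (y : A) ≤ (r ^ 2) • (1 : selfAdjoint A))
    (hw : (w : A) = Complex.I • ((c : A) * y - y * c)) :
    w ≤ r • (starMulSelf (c : A) + 1) := by
  have h1 := selfAdjoint_smul_nonneg hr.le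
    (starMulSelf_nonneg ((c : A) - (Complex.I * (r⁻¹ : ℝ)) • (y : A)))
  have h2 := selfAdjoint_smul_nonneg (inv_pos.2 hr).le (sub_nonneg.2 hy)
  rw [← sub_nonneg]
  convert add_nonneg h1 h2 using 1
  ext
  have hrc : (r : ℂ) ≠ 0 := by exact_mod_cast hr.ne'
  have e1 : ∀ a : A, r • a = (r : ℂ) • a := fun a => (Complex.coe_smul r a).symm
  have e2 : ∀ a : A, r⁻¹ • a = ((r : ℂ)⁻¹) • a := fun a => by
    rw [← Complex.ofReal_inv]
    exact (Complex.coe_smul r⁻¹ a).symm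
  have e3 : ∀ a : A, r ^ 2 • a = ((r : ℂ) ^ 2) • a := fun a => by
    rw [← Complex.ofReal_pow]
    exact (Complex.coe_smul (r ^ 2) a).symm
  simp only [starMulSelf, selfAdjoint.val_smul, AddSubgroup.coe_sub,
    AddSubgroup.coe_add, selfAdjoint.val_one, star_sub, star_smul, hw, c.2.star_eq, y.2.star_eq,
    sub_mul, mul_sub, smul_mul_assoc, mul_smul_comm, e1, e2, e3, star_mul, Complex.star_def,
    Complex.conj_I, Complex.ofReal_inv]
  match_scalars <;> field_simp <;> simp [hrc]

theorem eq_zero_of_forall_le_smul (hArch : IsArchimedean A) {v w : selfAdjoint A}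
    (h1 : ∀ ε : ℝ, 0 < ε → v ≤ ε • w) (h2 : ∀ ε : ℝ, 0 < ε → -v ≤ ε • w) : v = 0 :=
  le_antisymm (hArch v w h1) (by simpa using hArch (-v) w h2)

/-- The bicommutant of a set of Hermitian elements is closed under uniform limits. -/
theorem mem_bicommutant_of_approx (hArch : IsArchimedean A) {S : Set A}
    (hsa : ∀ s ∈ S, IsSelfAdjoint s) {l : selfAdjoint A}
    (hl : ∀ ε : ℝ, 0 < ε → ∃ x : selfAdjoint A, (x : A) ∈ bicommutant S ∧
      starMulSelf ((x - l : selfAdjoint A) : A) ≤ (ε ^ 2) • (1 : selfAdjoint A)) :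
    (l : A) ∈ bicommutant S := by
  have key : ∀ c : selfAdjoint A, (c : A) ∈ Set.centralizer S → Commute (c : A) (l : A) := by
    intro c hc
    have hwsa : IsSelfAdjoint (Complex.I • ((c : A) * l - l * c)) := by
      rw [isSelfAdjoint_iff]
      simp only [star_smul, star_sub, star_mul, c.2.star_eq, l.2.star_eq, Complex.star_def,
        Complex.conj_I, neg_smul]
      rw [← smul_neg, neg_sub]
    let w : selfAdjoint A := ⟨_, hwsa⟩
    have hw : w = 0 := by
      refine eq_zero_of_forall_le_smul hArch (w := starMulSelf (c : A) + 1) ?_ ?_ <;>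
        intro ε hε <;> obtain ⟨x, hx, hxl⟩ := hl ε hε <;>
        have hcx : (c : A) * x = x * c := hx c hc
      · refine commutator_le hε (y := -(x - l)) ?_ ?_
        · rwa [show starMulSelf ((-(x - l) : selfAdjoint A) : A) =
            starMulSelf ((x - l : selfAdjoint A) : A) from
            Subtype.ext (by rw [AddSubgroup.coe_neg]; simp only [starMulSelf, star_neg, neg_mul_neg])]
        · simp only [w, AddSubgroup.coe_sub, neg_sub, mul_sub, sub_mul, hcx]
          congr 1
          abel
      · refine commutator_le hε hxl ?_
        simp only [w, AddSubgroup.coe_sub, AddSubgroup.coe_neg, mul_sub, sub_mul, hcx]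
        rw [← smul_neg]
        congr 1
        abel
    have h0 : Complex.I • ((c : A) * l - l * c) = 0 := congrArg Subtype.val hw
    exact sub_eq_zero.1 ((smul_eq_zero_iff_right Complex.I_ne_zero).1 h0)
  intro c hc
  have hc' : ∀ s ∈ S, Commute c s := fun s hs => (hc s hs).symm
  have hsc : ∀ s ∈ S, Commute (star c) s := fun s hs => by
    have := (hc' s hs).star_star
    rwa [(hsa s hs).star_eq] at this
  -- as `S` consists of Hermitian elements, the Hermitian parts of `c` commute with `S` as well
  have hre := key (ℜ c) fun s hs => by
    rw [realPart_apply_coe]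
    exact (((hc' s hs).add_left (hsc s hs)).smul_left _).symm
  have him := key (ℑ c) fun s hs => by
    rw [imaginaryPart_apply_coe]
    exact ((((hc' s hs).sub_left (hsc s hs)).smul_left _).smul_left _).symm
  rw [← realPart_add_I_smul_imaginaryPart c]
  exact hre.add_left (him.smul_left _)

/-- A uniform limit `l` of elements of `hermitianBicommutant S` may be replaced by its Hermitian
part, which lies in the bicommutant by `mem_bicommutant_of_approx`. -/
theorem isOrderUnitComplete_hermitianBicommutant (hArch : IsArchimedean A)
    (hComplete : IsUniformlyComplete A) {S : Set A}
    (hsa : ∀ s ∈ S, IsSelfAdjoint s) (hcomm : ∀ s ∈ S, ∀ t ∈ S, s * t = t * s) :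
    IsOrderUnitComplete (hermitianBicommutant S hcomm) := by
  intro u hu
  obtain ⟨l, hl⟩ := hComplete (fun n => (u n : A)) fun ε hε => by
    obtain ⟨N, hN⟩ := hu (ε / 2) (by positivity)
    refine ⟨N, fun m n hm hn => lt_of_le_of_lt (uniformDist_le (half_pos hε) ?_) (half_lt_self hε)⟩
    refine starMulSelf_le_of_bounds hArch (y := toSelfAdjoint (u m - u n)) ?_
      (hN m n hm hn)
    rw [neg_le]
    have h := hN n m hn hm
    rwa [← neg_sub] at h
  have hre : ∀ n, ℜ ((u n : A) - l) = toSelfAdjoint (u n) - ℜ l := fun n => by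
    rw [map_sub]
    congr 1
    exact selfAdjoint.realPart_coe (x := toSelfAdjoint (u n))
  have approx : ∀ ε : ℝ, 0 < ε → ∃ N : ℕ, ∀ n : ℕ, N ≤ n →
      -(ε • (1 : selfAdjoint A)) ≤ toSelfAdjoint (u n) - ℜ l ∧
        toSelfAdjoint (u n) - ℜ l ≤ ε • (1 : selfAdjoint A) := fun ε hε => by
    obtain ⟨N, hN⟩ := hl (min ε 1) (by positivity)
    refine ⟨N, fun n hn => ?_⟩
    obtain ⟨r, hr0, hr, hle⟩ := exists_of_uniformDist_lt (min_le_right _ _) (hN n hn)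
    have h := selfAdjoint_bounds_of_starMulSelf_le hr0 hle
    have hrε : r • (1 : selfAdjoint A) ≤ ε • (1 : selfAdjoint A) := by
      rw [← sub_nonneg, ← sub_smul]
      exact selfAdjoint_smul_nonneg (sub_nonneg.2 (hr.le.trans (min_le_left _ _)))
        IsOrderedStarAlgebra.zero_le_one
    rw [hre] at h
    exact ⟨(neg_le_neg hrε).trans h.1, h.2.trans hrε⟩
  have hmem : ((ℜ l : selfAdjoint A) : A) ∈ bicommutant S := by
    refine mem_bicommutant_of_approx hArch hsa fun ε hε => ?_
    obtain ⟨N, hN⟩ := approx ε hε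
    obtain ⟨h1, h2⟩ := hN N le_rfl
    exact ⟨toSelfAdjoint (u N), (u N).2.2, starMulSelf_le_of_bounds hArch h1 h2⟩
  exact ⟨⟨ℜ l, (ℜ l).2, hmem⟩, approx⟩

end Order

end HermitianBicommutant

section Implications

variable {A : Type*} [Ring A] [StarRing A] [Algebra ℂ A] [StarModule ℂ A]

/-! ### The equivalent conditions -/

variable [PartialOrder (selfAdjoint A)] [IsOrderedStarAlgebra A]

theorem isCoerciveElem_starMulSelf_add_one (a : A) : IsCoerciveElem (starMulSelf a + 1) :=
  ⟨1, one_pos, by simpa using starMulSelf_nonneg a⟩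

theorem isSymmetricAlgebra_of_isUnit_sq_add_one (hArch : IsArchimedean A)
    (hComplete : IsUniformlyComplete A) (h : ∀ a : selfAdjoint A, IsUnit ((a : A) ^ 2 + 1)) :
    IsSymmetricAlgebra A := by
  rintro a ⟨ε, hε, ha⟩
  have hsa := isSelfAdjoint_of_mem_singleton a
  have hcomm := mul_comm_of_mem_singleton (a : A)
  have := isArchimedeanSquareOrdered_hermitianBicommutant hArch hcomm
  have hR := isOrderUnitComplete_hermitianBicommutant hArch hComplete hsa hcomm
  let x : hermitianBicommutant _ hcomm := ⟨a, a.2, subset_bicommutant _ rfl⟩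
  obtain ⟨z, hz⟩ := exists_mul_eq_one_of_isUnit (x := x ^ 2 + 1) (h a)
  exact isUnit_coe (isUnit_of_sq_add_one_inv hR (a := x) hε ha hz)

theorem isUnit_sq_add_one_of_isSymmetricAlgebra (h : IsSymmetricAlgebra A) (a : selfAdjoint A) :
    IsUnit ((a : A) ^ 2 + 1) := by
  have h1 := h _ (isCoerciveElem_starMulSelf_add_one (a : A))
  rwa [show ((starMulSelf (a : A) + 1 : selfAdjoint A) : A) = (a : A) ^ 2 + 1 by
    simp [starMulSelf, sq, a.2.star_eq]] at h1

theorem isRadicalAlgebra_of_isSymmetricAlgebra (hArch : IsArchimedean A)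
    (h : IsSymmetricAlgebra A) : IsRadicalAlgebra A := by
  rintro a b hab ⟨ε, hε, ha⟩ hnonneg
  have hcomm := mul_comm_of_mem_pair hab
  have := isArchimedeanSquareOrdered_hermitianBicommutant hArch hcomm
  let x : hermitianBicommutant _ hcomm := ⟨a, a.2, subset_bicommutant _ (Or.inl rfl)⟩
  let y : hermitianBicommutant _ hcomm := ⟨b, b.2, subset_bicommutant _ (Or.inr rfl)⟩
  obtain ⟨z, hz⟩ := exists_mul_eq_one_of_isUnit (x := x) (h a ⟨ε, hε, ha⟩)
  exact nonneg_of_mul_nonneg_of_inv (a := x) (b := y) hε ha hz hnonneg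

theorem exists_isSquareRoot_of_isSymmetricAlgebra (hArch : IsArchimedean A)
    (hComplete : IsUniformlyComplete A) (h : IsSymmetricAlgebra A) (a : selfAdjoint A)
    (ha : 0 ≤ a) : ∃ x : selfAdjoint A, IsSquareRoot a x := by
  have hsa := isSelfAdjoint_of_mem_singleton a
  have hcomm := mul_comm_of_mem_singleton (a : A)
  have := isArchimedeanSquareOrdered_hermitianBicommutant hArch hcomm
  have hR := isOrderUnitComplete_hermitianBicommutant hArch hComplete hsa hcomm
  let x : hermitianBicommutant _ hcomm := ⟨a, a.2, subset_bicommutant _ rfl⟩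
  obtain ⟨z, hz⟩ := exists_mul_eq_one_of_isUnit (x := 1 + x)
    (h (1 + a) ⟨1, one_pos, by simpa using ha⟩)
  obtain ⟨y, hy0, hy⟩ := exists_sqrt_of_inv hR (a := x) ha hz
  exact ⟨toSelfAdjoint y, y.2.2, hy0, congrArg Subtype.val hy⟩

/-- The absolute value of `a` is the square root of `a ^ 2`. -/
theorem exists_isAbsoluteValue_of_isSquareRoot
    (h : ∀ a : selfAdjoint A, 0 ≤ a → ∃ x : selfAdjoint A, IsSquareRoot a x) (a : selfAdjoint A) :
    ∃ x : selfAdjoint A, IsAbsoluteValue a x := by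
  obtain ⟨x, hx, hx0, hxa⟩ := h _ (starMulSelf_nonneg (a : A))
  refine ⟨x, bicommutant_subset_bicommutant ?_ hx, ?_, ?_⟩
  · rintro _ rfl
    have ha := subset_bicommutant {(a : A), ((-a : selfAdjoint A) : A)} (Or.inl rfl)
    have := Set.mul_mem_centralizer ha ha
    rwa [show ((starMulSelf (a : A) : selfAdjoint A) : A) = (a : A) * a by
      simp [starMulSelf, a.2.star_eq]]
  · rw [add_neg_cancel]
    exact selfAdjoint_smul_nonneg two_pos.le hx0
  · rw [hxa]
    simp [starMulSelf, a.2.star_eq]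

/-- Lattice operations from absolute values: `a ∨ b = (a + b + |a - b|) / 2` and
`a ∧ b = (a + b - |a - b|) / 2`. -/
theorem exists_isVee_isWedge_of_isAbsoluteValue
    (h : ∀ a : selfAdjoint A, ∃ x : selfAdjoint A, IsAbsoluteValue a x) (a b : selfAdjoint A)
    (hab : Commute (a : A) (b : A)) :
    (∃ x : selfAdjoint A, IsVee a b x) ∧ (∃ x : selfAdjoint A, IsWedge a b x) := by
  have hcomm := mul_comm_of_mem_pair hab
  obtain ⟨y, hy, hy0, hyeq⟩ := h (a - b)
  let x₁ : hermitianBicommutant _ hcomm := ⟨a, a.2, subset_bicommutant _ (Or.inl rfl)⟩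
  let x₂ : hermitianBicommutant _ hcomm := ⟨b, b.2, subset_bicommutant _ (Or.inr rfl)⟩
  have hmem : (y : A) ∈ bicommutant {(a : A), (b : A)} := by
    refine bicommutant_subset_bicommutant ?_ hy
    rintro _ (rfl | rfl)
    · exact (x₁ - x₂).2.2
    · exact (-(x₁ - x₂)).2.2
  let z : hermitianBicommutant _ hcomm := ⟨y, y.2, hmem⟩
  have hy1 : 0 ≤ y := by
    rw [add_neg_cancel] at hy0
    exact selfAdjoint_nonneg_of_smul_nonneg two_pos hy0
  have hz : z ^ 2 + (x₁ - x₂) * -(x₁ - x₂) = z * ((x₁ - x₂) + -(x₁ - x₂)) := Subtype.ext hyeq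
  have hz2 : z ^ 2 = (x₁ - x₂) ^ 2 := by linear_combination hz
  have key : ∀ t : ℝ, t ^ 2 = 1 → ∀ w : hermitianBicommutant _ hcomm,
      w = (1 / 2 : ℝ) • (x₁ + x₂ + t • z) → w ^ 2 + x₁ * x₂ = w * (x₁ + x₂) := by
    rintro t ht w rfl
    have e : ((1 / 2 : ℝ) • (x₁ + x₂ + t • z)) ^ 2 - (1 / 2 : ℝ) • (x₁ + x₂ + t • z) * (x₁ + x₂) =
        (1 / 4 : ℝ) • (t ^ 2 • z ^ 2 - (x₁ + x₂) ^ 2) := by algebra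
    have e' : (1 / 4 : ℝ) • ((1 : ℝ) • (x₁ - x₂) ^ 2 - (x₁ + x₂) ^ 2) = -(x₁ * x₂) := by algebra
    rw [ht, hz2, e'] at e
    linear_combination e
  refine ⟨⟨toSelfAdjoint ((1 / 2 : ℝ) • (x₁ + x₂ + (1 : ℝ) • z)),
    ((1 / 2 : ℝ) • (x₁ + x₂ + (1 : ℝ) • z)).2.2, ?_,
    congrArg Subtype.val (key 1 (by norm_num) _ rfl)⟩,
    ⟨toSelfAdjoint ((1 / 2 : ℝ) • (x₁ + x₂ + (-1 : ℝ) • z)),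
    ((1 / 2 : ℝ) • (x₁ + x₂ + (-1 : ℝ) • z)).2.2, ?_,
    congrArg Subtype.val (key (-1) (by norm_num) _ rfl)⟩⟩
  · have e : (2 : ℝ) • toSelfAdjoint ((1 / 2 : ℝ) • (x₁ + x₂ + (1 : ℝ) • z)) = a + b + y := by
      ext
      change (2 : ℝ) • ((1 / 2 : ℝ) • ((a : A) + b + (1 : ℝ) • (y : A))) = (a : A) + b + y
      module
    rw [e]
    exact le_add_of_nonneg_right hy1
  · have e : (2 : ℝ) • toSelfAdjoint ((1 / 2 : ℝ) • (x₁ + x₂ + (-1 : ℝ) • z)) = a + b - y := by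
      ext
      change (2 : ℝ) • ((1 / 2 : ℝ) • ((a : A) + b + (-1 : ℝ) • (y : A))) = (a : A) + b - y
      module
    rw [e]
    exact sub_le_self _ hy1

/-- Scaling the existence of `a ∧ 1` gives all truncations `a ∧ (n + 1)`, so that
`isUnit_of_forall_wedge` applies. -/
theorem isSymmetricAlgebra_of_isWedge_one (hArch : IsArchimedean A)
    (hComplete : IsUniformlyComplete A) (hrad : IsRadicalAlgebra A)
    (h : ∀ a : selfAdjoint A, IsCoerciveElem a → ∃ x : selfAdjoint A, IsWedge a 1 x) :
    IsSymmetricAlgebra A := by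
  rintro a ⟨ε, hε, ha⟩
  have hsa := isSelfAdjoint_of_mem_singleton a
  have hcomm := mul_comm_of_mem_singleton (a : A)
  have := isArchimedeanSquareOrdered_hermitianBicommutant hArch hcomm
  have hR := isOrderUnitComplete_hermitianBicommutant hArch hComplete hsa hcomm
  let x : hermitianBicommutant _ hcomm := ⟨a, a.2, subset_bicommutant _ rfl⟩
  refine isUnit_coe (isUnit_of_forall_wedge hR ?_ (a := x) hε ha fun n => ?_)
  · intro b c δ hδ hb hbc
    exact hrad (toSelfAdjoint b) (toSelfAdjoint c)
      (commute_of_mem_bicommutant hcomm b.2.2 c.2.2) ⟨δ, hδ, hb⟩ hbc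
  · -- `a ∧ r = r (r⁻¹ a ∧ 1)` for a constant `r > 0`
    obtain ⟨r, hrn⟩ : ∃ r : ℝ, r = n + 1 := ⟨_, rfl⟩
    rw [← hrn]
    have hr : 0 < r := by rw [hrn]; positivity
    obtain ⟨y, hy, hy2, hyeq⟩ := h (r⁻¹ • a) ⟨r⁻¹ * ε, by positivity, by
      have := selfAdjoint_smul_nonneg (inv_pos.2 hr).le (sub_nonneg.2 ha)
      rwa [smul_sub, smul_smul, sub_nonneg] at this⟩
    have hmem : (y : A) ∈ bicommutant {(a : A)} := by
      refine bicommutant_subset_bicommutant ?_ hy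
      rintro _ (rfl | rfl)
      · exact smul_mem_bicommutant r⁻¹ (subset_bicommutant _ rfl)
      · exact Set.one_mem_centralizer
    let z : hermitianBicommutant _ hcomm := ⟨y, y.2, hmem⟩
    have hz : z ^ 2 + (r⁻¹ • x) * 1 = z * (r⁻¹ • x + 1) := Subtype.ext hyeq
    have hz2 : (2 : ℝ) • z ≤ r⁻¹ • x + 1 := hy2
    have hx : x = r • (r⁻¹ • x) := (smul_inv_smul₀ hr.ne' x).symm
    generalize r⁻¹ • x = v at hz hz2 hx
    refine ⟨r • z, ?_, ?_⟩
    · have e : (r • v - r • z) * (r • 1 - r • z) =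
          (r ^ 2) • (z ^ 2 + v * 1 - z * (v + 1)) := by algebra
      rw [hx, e, hz, sub_self, smul_zero]
    · have e : (r • v - r • z) + (r • 1 - r • z) = r • (v + 1 - (2 : ℝ) • z) := by algebra
      rw [hx, e]
      exact smul_nonneg hr.le (sub_nonneg.2 hz2)

end Implications

end OrdStar

theorem mainTheorem1 {A : Type*} [Ring A] [StarRing A] [Algebra ℂ A] [StarModule ℂ A]
    [PartialOrder (selfAdjoint A)] [OrdStar.IsOrderedStarAlgebra A]
    (hArch : OrdStar.IsArchimedean A) (hComplete : OrdStar.IsUniformlyComplete A) :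
    List.TFAE
      [ ∀ a : selfAdjoint A,
          IsUnit ((a : A) + Complex.I • (1 : A)) ∧ IsUnit ((a : A) - Complex.I • (1 : A)),
        OrdStar.IsSymmetricAlgebra A,
        OrdStar.IsRadicalAlgebra A ∧
          ∀ a : selfAdjoint A, 0 ≤ a → ∃ x : selfAdjoint A, OrdStar.IsSquareRoot a x,
        OrdStar.IsRadicalAlgebra A ∧
          ∀ a : selfAdjoint A, ∃ x : selfAdjoint A, OrdStar.IsAbsoluteValue a x,
        OrdStar.IsPhiStarAlgebra A,
        OrdStar.IsRadicalAlgebra A ∧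
          ∀ a : selfAdjoint A, OrdStar.IsCoerciveElem a →
            ∃ x : selfAdjoint A, OrdStar.IsWedge a 1 x ] := by
  tfae_have 1 → 2 := fun h => OrdStar.isSymmetricAlgebra_of_isUnit_sq_add_one hArch hComplete
    fun a => (OrdStar.isUnit_add_I_and_sub_I_iff (a : A)).1 (h a)
  tfae_have 2 → 1 := fun h a => (OrdStar.isUnit_add_I_and_sub_I_iff (a : A)).2
    (OrdStar.isUnit_sq_add_one_of_isSymmetricAlgebra h a)
  tfae_have 2 → 3 := fun h => ⟨OrdStar.isRadicalAlgebra_of_isSymmetricAlgebra hArch h,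
    OrdStar.exists_isSquareRoot_of_isSymmetricAlgebra hArch hComplete h⟩
  tfae_have 3 → 4 := fun h => ⟨h.1, OrdStar.exists_isAbsoluteValue_of_isSquareRoot h.2⟩
  tfae_have 4 → 5 := fun h => ⟨inferInstance, hArch, h.1,
    OrdStar.exists_isVee_isWedge_of_isAbsoluteValue h.2⟩
  tfae_have 5 → 6 := fun h => ⟨h.2.2.1, fun a _ => (h.2.2.2 a 1 (Commute.one_right _)).2⟩
  tfae_have 6 → 2 := fun h => OrdStar.isSymmetricAlgebra_of_isWedge_one hArch hComplete h.1 h.2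
  tfae_finish
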